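/- **Corollary 2.8.** An MV-algebra is an algebra $\langle A,\oplus,\neg,0\rangle$ of type $(2,1,0)$ satisfying the equations $(x\oplus y)\oplus z\approx x\oplus(y\oplus z)$, $x\oplus y\approx y\oplus x$, $x\oplus 0\approx x$, $\neg\neg x\approx x$, $x\oplus\neg 0\approx\neg 0$ and $\neg(\neg x\oplus y)\oplus y\approx\neg(x\oplus\neg y)\oplus x$. A class of MV-algebras is a *variety* if it is closed under homomorphic images, subalgebras and direct products, and a *quasivariety* if it is closed under isomorphic images, subalgebras and reduced products; products and reduced products of the empty family are allowed, so every variety and every quasivariety contains the one-element algebras. A class of MV-algebras is *locally finite* if in each of its members every finitely generated subalgebra is finite. (1) For every locally finite variety $\mathbb{V}$ of MV-algebras, there are only finitely many quasivarieties $\mathbb{K}$ of MV-algebras with $\mathbb{K}\subseteq\mathbb{V}$. (2) Consequently, the collection of all locally finite quasivarieties of MV-algebras is countable (that is, finite or countably infinite). -/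

import Mathlib

universe u v

/-- An MV-algebra: an algebra `⟨A, ⊕, ¬, 0⟩` of type `(2, 1, 0)` satisfying the equations
MV1 to MV6. -/
class MVAlgebra (A : Type u) where
  /-- truncated addition `x ⊕ y` -/
  oplus : A → A → A
  /-- negation `¬ x` -/
  neg : A → A
  /-- the constant `0` -/
  zero : A
  oplus_assoc : ∀ x y z : A, oplus (oplus x y) z = oplus x (oplus y z)
  oplus_comm : ∀ x y : A, oplus x y = oplus y x
  oplus_zero : ∀ x : A, oplus x zero = x
  neg_neg : ∀ x : A, neg (neg x) = x
  oplus_neg_zero : ∀ x : A, oplus x (neg zero) = neg zero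
  oplus_symm : ∀ x y : A,
    oplus (neg (oplus (neg x) y)) y = oplus (neg (oplus x (neg y))) x

/-- Homomorphisms of MV-algebras. -/
structure IsMVHom {A : Type u} {B : Type v} [MVAlgebra A] [MVAlgebra B] (f : A → B) : Prop where
  map_oplus : ∀ x y : A, f (MVAlgebra.oplus x y) = MVAlgebra.oplus (f x) (f y)
  map_neg : ∀ x : A, f (MVAlgebra.neg x) = MVAlgebra.neg (f x)
  map_zero : f MVAlgebra.zero = MVAlgebra.zero

/-- Subalgebras of an MV-algebra: subsets closed under the three operations. -/
structure MVSubalgebra (A : Type u) [MVAlgebra A] where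
  /-- the underlying set -/
  carrier : Set A
  oplus_mem : ∀ {x y : A}, x ∈ carrier → y ∈ carrier → MVAlgebra.oplus x y ∈ carrier
  neg_mem : ∀ {x : A}, x ∈ carrier → MVAlgebra.neg x ∈ carrier
  zero_mem : MVAlgebra.zero ∈ carrier

/-- A subalgebra is an MV-algebra under the restricted operations. -/
instance MVSubalgebra.instMVAlgebra {A : Type u} [MVAlgebra A] (S : MVSubalgebra A) :
    MVAlgebra S.carrier where
  oplus x y := ⟨MVAlgebra.oplus x.1 y.1, S.oplus_mem x.2 y.2⟩
  neg x := ⟨MVAlgebra.neg x.1, S.neg_mem x.2⟩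
  zero := ⟨MVAlgebra.zero, S.zero_mem⟩
  oplus_assoc x y z := Subtype.ext (MVAlgebra.oplus_assoc x.1 y.1 z.1)
  oplus_comm x y := Subtype.ext (MVAlgebra.oplus_comm x.1 y.1)
  oplus_zero x := Subtype.ext (MVAlgebra.oplus_zero x.1)
  neg_neg x := Subtype.ext (MVAlgebra.neg_neg x.1)
  oplus_neg_zero x := Subtype.ext (MVAlgebra.oplus_neg_zero x.1)
  oplus_symm x y := Subtype.ext (MVAlgebra.oplus_symm x.1 y.1)

/-- The subalgebra generated by a set: the intersection of all subalgebras containing it. -/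
def MVSubalgebra.closure {A : Type u} [MVAlgebra A] (s : Set A) : MVSubalgebra A where
  carrier := {x | ∀ S : MVSubalgebra A, s ⊆ S.carrier → x ∈ S.carrier}
  oplus_mem hx hy S hS := S.oplus_mem (hx S hS) (hy S hS)
  neg_mem hx S hS := S.neg_mem (hx S hS)
  zero_mem S _ := S.zero_mem

/-- An MV-algebra is locally finite if its finitely generated subalgebras are finite. -/
def MVAlgebra.LocallyFinite (A : Type u) [MVAlgebra A] : Prop :=
  ∀ s : Set A, s.Finite → (MVSubalgebra.closure s).carrier.Finite

/-- The direct product of a family of MV-algebras, with componentwise operations. -/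
instance MVAlgebra.instPi {ι : Type v} (A : ι → Type u) [∀ i, MVAlgebra (A i)] :
    MVAlgebra (∀ i, A i) where
  oplus x y i := MVAlgebra.oplus (x i) (y i)
  neg x i := MVAlgebra.neg (x i)
  zero _ := MVAlgebra.zero
  oplus_assoc x y z := funext fun i => MVAlgebra.oplus_assoc (x i) (y i) (z i)
  oplus_comm x y := funext fun i => MVAlgebra.oplus_comm (x i) (y i)
  oplus_zero x := funext fun i => MVAlgebra.oplus_zero (x i)
  neg_neg x := funext fun i => MVAlgebra.neg_neg (x i)
  oplus_neg_zero x := funext fun i => MVAlgebra.oplus_neg_zero (x i)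
  oplus_symm x y := funext fun i => MVAlgebra.oplus_symm (x i) (y i)

/-- The reduced product of a family of MV-algebras over a filter `F`: the quotient `F.Product A`
of the direct product that identifies two families when they agree on a member of `F`. -/
instance MVAlgebra.instReducedProduct {ι : Type v} (F : Filter ι) (A : ι → Type u)
    [∀ i, MVAlgebra (A i)] : MVAlgebra (F.Product A) where
  oplus := Quotient.map₂ (sa := F.productSetoid A) (sb := F.productSetoid A)
    (sc := F.productSetoid A) (fun x y i => MVAlgebra.oplus (x i) (y i))
    (fun x x' hx y y' hy => by
      filter_upwards [hx, hy] with i h₁ h₂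
      rw [h₁, h₂])
  neg := Quotient.map (sa := F.productSetoid A) (sb := F.productSetoid A)
    (fun x i => MVAlgebra.neg (x i))
    (fun x x' hx => by
      filter_upwards [hx] with i h
      rw [h])
  zero := Quotient.mk (F.productSetoid A) (fun _ => MVAlgebra.zero)
  oplus_assoc := by
    rintro ⟨x⟩ ⟨y⟩ ⟨z⟩
    exact congrArg (Quotient.mk (F.productSetoid A)) (MVAlgebra.oplus_assoc x y z)
  oplus_comm := by
    rintro ⟨x⟩ ⟨y⟩
    exact congrArg (Quotient.mk (F.productSetoid A)) (MVAlgebra.oplus_comm x y)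
  oplus_zero := by
    rintro ⟨x⟩
    exact congrArg (Quotient.mk (F.productSetoid A)) (MVAlgebra.oplus_zero x)
  neg_neg := by
    rintro ⟨x⟩
    exact congrArg (Quotient.mk (F.productSetoid A)) (MVAlgebra.neg_neg x)
  oplus_neg_zero := by
    rintro ⟨x⟩
    exact congrArg (Quotient.mk (F.productSetoid A)) (MVAlgebra.oplus_neg_zero x)
  oplus_symm := by
    rintro ⟨x⟩ ⟨y⟩
    exact congrArg (Quotient.mk (F.productSetoid A)) (MVAlgebra.oplus_symm x y)

/-- Bundled MV-algebras. A class of MV-algebras is a `Set MVAlg.{u}`. -/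
structure MVAlg where
  /-- the underlying type -/
  carrier : Type u
  /-- the MV-algebra structure -/
  str : MVAlgebra carrier

instance MVAlg.instCoeSort : CoeSort MVAlg.{u} (Type u) := ⟨MVAlg.carrier⟩

instance MVAlg.instMVAlgebra (A : MVAlg.{u}) : MVAlgebra A := A.str

/-- Bundle an MV-algebra. -/
def MVAlg.of (A : Type u) [MVAlgebra A] : MVAlg.{u} := ⟨A, inferInstance⟩

/-- A variety of MV-algebras: a class closed under homomorphic images, subalgebras and direct
products (of arbitrary, possibly empty, families). -/
structure IsMVVariety (K : Set MVAlg.{u}) : Prop where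
  closed_hom : ∀ A ∈ K, ∀ (B : MVAlg.{u}) (f : A → B),
    IsMVHom f → Function.Surjective f → B ∈ K
  closed_sub : ∀ A ∈ K, ∀ S : MVSubalgebra A, MVAlg.of S.carrier ∈ K
  closed_prod : ∀ (ι : Type u) (A : ι → MVAlg.{u}), (∀ i, A i ∈ K) → MVAlg.of (∀ i, A i) ∈ K

/-- A quasivariety of MV-algebras: a class closed under isomorphic images, subalgebras and reduced
products (of arbitrary, possibly empty, families over arbitrary filters). -/
structure IsMVQuasivariety (K : Set MVAlg.{u}) : Prop where
  closed_iso : ∀ A ∈ K, ∀ (B : MVAlg.{u}) (f : A → B),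
    IsMVHom f → Function.Bijective f → B ∈ K
  closed_sub : ∀ A ∈ K, ∀ S : MVSubalgebra A, MVAlg.of S.carrier ∈ K
  closed_reducedProd : ∀ (ι : Type u) (F : Filter ι) (A : ι → MVAlg.{u}), (∀ i, A i ∈ K) →
    MVAlg.of (F.Product fun i => A i) ∈ K

/-- A class of MV-algebras is locally finite if all its members are. -/
def IsLocallyFiniteMVClass (K : Set MVAlg.{u}) : Prop :=
  ∀ A ∈ K, MVAlgebra.LocallyFinite A

/-! A locally finite class closed under direct products satisfies `(N + 1) x = N x` for a single
`N`: otherwise a product of counterexamples, one for each `N`, has an element with infinitely many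
distinct multiples (`exists_isPotent`). Under this law every `N x` is idempotent. A finite algebra
splits along its idempotents, and an indecomposable factor consists of the multiples `0, a, …, N a`
of an atom (`IsPotent.exists_generator`, `IsPotent.exists_pi_equiv`), so only finitely many factors
are possible up to isomorphism.

A quasivariety is determined by its finitely generated members (`mem_of_closure_mem`), and whether
it contains a product depends only on which factors occur (`pi_mem_of_range_eq`). For fixed `N` it
is thus coded by a family of subsets of a finite set (`factorSets`). This gives (1); the union over
all `N` gives (2). -/

open MVAlgebra

local infixl:65 " ⊹ " => MVAlgebra.oplus
local prefix:max "∼" => MVAlgebra.neg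

/-! ### Arithmetic in MV-algebras -/

namespace MVAlgebra

section Arithmetic

variable {A : Type u} [MVAlgebra A]

theorem zero_oplus (x : A) : zero ⊹ x = x := by rw [oplus_comm, oplus_zero]

theorem neg_zero_oplus (x : A) : ∼zero ⊹ x = ∼zero := by rw [oplus_comm, oplus_neg_zero]

theorem neg_oplus_self (x : A) : ∼x ⊹ x = ∼zero := by
  have h := oplus_symm x (∼zero)
  rwa [oplus_neg_zero, neg_neg, oplus_zero, eq_comm] at h

theorem oplus_right_comm (x y z : A) : x ⊹ y ⊹ z = x ⊹ z ⊹ y := by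
  rw [oplus_assoc, oplus_comm y, oplus_assoc]

theorem oplus_oplus_oplus_comm (x y z w : A) : x ⊹ y ⊹ (z ⊹ w) = x ⊹ z ⊹ (y ⊹ w) := by
  rw [oplus_assoc, ← oplus_assoc y, oplus_comm y z, oplus_assoc z, oplus_assoc]

/-- The natural order of an MV-algebra. -/
def Le (x y : A) : Prop := ∼x ⊹ y = ∼zero

theorem Le.refl (x : A) : Le x x := neg_oplus_self x

theorem Le.antisymm {x y : A} (hxy : Le x y) (hyx : Le y x) : x = y := by
  have h := oplus_symm x y
  unfold Le at hxy hyx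
  rw [hxy, oplus_comm x, hyx, neg_neg, zero_oplus, zero_oplus] at h
  exact h.symm

theorem le_oplus (x z : A) : Le x (x ⊹ z) := by
  unfold Le
  rw [← oplus_assoc, neg_oplus_self, neg_zero_oplus]

theorem le_oplus_left (x z : A) : Le x (z ⊹ x) := by
  rw [oplus_comm]; exact le_oplus x z

/-- If `x ≤ y` then `(y ⊖ x) ⊕ x = y`. -/
theorem Le.sub_oplus {x y : A} (h : Le x y) : ∼(x ⊹ ∼y) ⊹ x = y := by
  rw [← oplus_symm, h, neg_neg, zero_oplus]

theorem Le.exists_oplus {x y : A} (h : Le x y) : ∃ z, y = x ⊹ z :=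
  ⟨∼(x ⊹ ∼y), by rw [oplus_comm x (∼_), h.sub_oplus]⟩

theorem Le.trans {x y z : A} (hxy : Le x y) (hyz : Le y z) : Le x z := by
  obtain ⟨a, rfl⟩ := hxy.exists_oplus
  obtain ⟨b, rfl⟩ := hyz.exists_oplus
  rw [oplus_assoc]
  exact le_oplus _ _

theorem Le.oplus_right {x y : A} (h : Le x y) (z : A) : Le (x ⊹ z) (y ⊹ z) := by
  obtain ⟨a, rfl⟩ := h.exists_oplus
  rw [oplus_right_comm]
  exact le_oplus _ _

theorem Le.neg {x y : A} (h : Le x y) : Le (∼y) (∼x) := by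
  unfold Le at *
  rwa [neg_neg, oplus_comm]

theorem le_neg_zero (x : A) : Le x (∼zero) := oplus_neg_zero _

theorem zero_le (x : A) : Le zero x := neg_zero_oplus x

theorem eq_zero_of_neg_eq {x : A} (h : ∼x = ∼zero) : x = zero := by
  rw [← neg_neg x, h, neg_neg]

/-- The supremum of `y` and `e` is `y ⊕ e` for idempotent `e`. -/
theorem sup_idempotent {e : A} (he : e ⊹ e = e) (y : A) : ∼(∼y ⊹ e) ⊹ e = y ⊹ e := by
  apply Le.antisymm
  · apply Le.oplus_right
    have := (le_oplus (∼y) e).neg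
    rwa [neg_neg] at this
  · have h : Le y (∼(∼y ⊹ e) ⊹ e) := by
      rw [oplus_symm]; exact le_oplus_left _ _
    have := h.oplus_right e
    rwa [oplus_assoc, he] at this

theorem neg_oplus_idempotent {e : A} (he : e ⊹ e = e) (x : A) : ∼(x ⊹ e) ⊹ e = ∼x ⊹ e := by
  have := sup_idempotent he (∼x)
  rwa [neg_neg] at this

/-- MV6 at `e` and `∼e` yields `e ≤ e ⊙ e`, where `e ⊙ e` is `∼(∼e ⊹ ∼e)`; negate. -/
theorem neg_idempotent {e : A} (he : e ⊹ e = e) : ∼e ⊹ ∼e = ∼e := by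
  have h : Le e (∼(∼e ⊹ ∼e)) := by
    have h1 := oplus_symm e (∼e)
    rw [neg_neg, he, neg_oplus_self] at h1
    rwa [Le, oplus_comm]
  have h2 := h.neg
  rw [neg_neg] at h2
  exact h2.antisymm (le_oplus _ _)

/-- An element is the sum of its components along an idempotent and its complement. -/
theorem split_idempotent {e : A} (he : e ⊹ e = e) (x : A) :
    ∼(∼x ⊹ ∼e) ⊹ ∼(∼x ⊹ e) = x := by
  have h : Le (∼(∼x ⊹ e)) x := by
    have := (le_oplus (∼x) e).neg
    rwa [neg_neg] at this
  -- Identifies the difference of `x` and `∼(∼x ⊹ e)` with the other component `∼(∼x ⊹ ∼e)`.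
  have h1 := oplus_symm (∼x) (∼e)
  rw [neg_neg, neg_neg, neg_oplus_idempotent (neg_idempotent he)] at h1
  have h2 := h.sub_oplus
  rwa [← h1] at h2

/-- `∼(y ⊹ ∼e)` lies below `e`, and an idempotent absorbs what lies below it. -/
theorem neg_oplus_neg_oplus_idempotent {e : A} (he : e ⊹ e = e) (y : A) :
    ∼(y ⊹ ∼e) ⊹ e = e := by
  apply Le.antisymm
  · have := ((le_oplus_left (∼e) y).neg).oplus_right e
    rwa [neg_neg, he] at this
  · exact le_oplus_left _ _

/-- The multiple `x ⊕ ⋯ ⊕ x`. -/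
def nmul : ℕ → A → A
  | 0, _ => zero
  | n + 1, x => nmul n x ⊹ x

theorem nmul_add (m n : ℕ) (x : A) : nmul (m + n) x = nmul m x ⊹ nmul n x := by
  induction n with
  | zero => exact (oplus_zero _).symm
  | succ n ih =>
    change nmul (m + n) x ⊹ x = nmul m x ⊹ (nmul n x ⊹ x)
    rw [ih, oplus_assoc]

theorem nmul_le {m n : ℕ} (h : m ≤ n) (x : A) : Le (nmul m x) (nmul n x) := by
  obtain ⟨k, rfl⟩ := Nat.exists_eq_add_of_le h
  rw [nmul_add]
  exact le_oplus _ _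

variable (A) in
/-- The law `(N + 1) x = N x`. -/
def IsPotent (N : ℕ) : Prop := ∀ x : A, nmul (N + 1) x = nmul N x

theorem IsPotent.add_eq {N : ℕ} (h : IsPotent A N) (k : ℕ) (x : A) :
    nmul (N + k) x = nmul N x := by
  induction k with
  | zero => rfl
  | succ k ih =>
    change nmul (N + k) x ⊹ x = nmul N x
    rw [ih]
    exact h x

theorem IsPotent.idempotent {N : ℕ} (h : IsPotent A N) (x : A) :
    nmul N x ⊹ nmul N x = nmul N x := by
  rw [← nmul_add, h.add_eq]

theorem IsPotent.nmul_ne_zero {N : ℕ} (h : IsPotent A N) {x : A} (hx : x ≠ zero) :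
    nmul N x ≠ zero := by
  intro h0
  have := h x
  change nmul N x ⊹ x = nmul N x at this
  rw [h0, zero_oplus] at this
  exact hx this

/-- If `y ∧ a = 0` and some multiple of `a` is `1`, then `y = 0`. -/
theorem eq_zero_of_inf_eq_zero {y a : A} (h : ∼(∼y ⊹ ∼(∼y ⊹ a)) = zero) {N : ℕ}
    (hN : nmul N a = ∼zero) : y = zero := by
  -- The hypothesis says that `∼y` absorbs `a`, hence all multiples of `a`, hence `1`.
  have h1 : Le (∼y ⊹ a) (∼y) := by
    rw [Le, oplus_comm, ← h, neg_neg]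
  have h2 : ∼y ⊹ a = ∼y := h1.antisymm (le_oplus _ _)
  have h3 : ∀ n, ∼y ⊹ nmul n a = ∼y := by
    intro n
    induction n with
    | zero => exact oplus_zero _
    | succ n ih =>
      change ∼y ⊹ (nmul n a ⊹ a) = ∼y
      rw [← oplus_assoc, ih, h2]
  have h4 := h3 N
  rw [hN, oplus_neg_zero] at h4
  exact eq_zero_of_neg_eq h4.symm

/-- In a finite MV-algebra satisfying `(N + 1) x = N x` without nontrivial idempotents, all
elements are multiples of one element. -/
theorem IsPotent.exists_generator [Finite A] {N : ℕ} (h : IsPotent A N)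
    (hid : ∀ e : A, e ⊹ e = e → e = zero ∨ e = ∼zero) :
    ∃ a : A, ∀ x : A, ∃ j ≤ N, x = nmul j a := by
  by_cases htriv : ∀ x : A, x = zero
  · exact ⟨zero, fun x => ⟨0, Nat.zero_le _, htriv x⟩⟩
  push Not at htriv
  have hone : ∀ x : A, x ≠ zero → nmul N x = ∼zero := fun x hx =>
    (hid _ (h.idempotent x)).resolve_left (h.nmul_ne_zero hx)
  -- An atom, found by descent on the size of the down-set.
  obtain ⟨a, ha, hmin⟩ : ∃ a : A, a ≠ zero ∧ ∀ b : A, b ≠ zero → Le b a → b = a := by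
    have hcard : ∀ n : ℕ, ∀ x : A, x ≠ zero → {y : A | Le y x}.ncard = n →
        ∃ a : A, a ≠ zero ∧ ∀ b : A, b ≠ zero → Le b a → b = a := by
      intro n
      induction n using Nat.strong_induction_on with
      | _ n ih =>
        intro x hx hn
        by_cases hm : ∀ b : A, b ≠ zero → Le b x → b = x
        · exact ⟨x, hx, hm⟩
        push Not at hm
        obtain ⟨b, hb, hbx, hne⟩ := hm
        refine ih _ ?_ b hb rfl
        rw [← hn]
        refine Set.ncard_lt_ncard ⟨fun y hy => Le.trans hy hbx, fun hsub => ?_⟩ (Set.toFinite _)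
        exact hne (hbx.antisymm (hsub (Le.refl x)))
    obtain ⟨x, hx⟩ := htriv
    exact hcard _ x hx rfl
  refine ⟨a, fun x => ?_⟩
  -- Climb the multiples of `a`: write `x = y ⊹ nmul k a`. If `y ∧ a = 0` then `y = 0` and `x` is
  -- reached; otherwise `y ∧ a = a` by minimality, and one more `a` fits below `x`.
  have key : ∀ k ≤ N, Le (nmul k a) x ∨ ∃ j ≤ N, x = nmul j a := by
    intro k
    induction k with
    | zero => exact fun _ => Or.inl (zero_le x)
    | succ k ih =>
      intro hk
      rcases ih (by omega) with hle | hex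
      · obtain ⟨y, hyx⟩ : ∃ y, y ⊹ nmul k a = x := ⟨_, hle.sub_oplus⟩
        by_cases hinf : ∼(∼y ⊹ ∼(∼y ⊹ a)) = zero
        · right
          have hy0 : y = zero := eq_zero_of_inf_eq_zero hinf (hone a ha)
          rw [hy0, zero_oplus] at hyx
          exact ⟨k, by omega, hyx.symm⟩
        · left
          have hley : Le (∼(∼y ⊹ ∼(∼y ⊹ a))) y := by
            have := (le_oplus (∼y) (∼(∼y ⊹ a))).neg
            rwa [neg_neg] at this
          have hlea : Le (∼(∼y ⊹ ∼(∼y ⊹ a))) a := by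
            have h1 := oplus_symm (∼y) (∼a)
            rw [neg_neg, neg_neg] at h1
            rw [oplus_comm (∼y) (∼_), ← h1, oplus_comm _ (∼a)]
            have := (le_oplus (∼a) (∼(y ⊹ ∼a))).neg
            rwa [neg_neg] at this
          rw [hmin _ hinf hlea] at hley
          have := hley.oplus_right (nmul k a)
          rw [hyx, oplus_comm] at this
          exact this
      · exact Or.inr hex
  rcases key N le_rfl with hle | hex
  · refine ⟨N, le_rfl, ?_⟩
    rw [hone a ha] at hle ⊢
    exact (le_neg_zero x).antisymm hle
  · exact hex

end Arithmetic

end MVAlgebra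

/-! ### Homomorphisms -/

section Hom

variable {A : Type*} {B : Type*} {C : Type*} [MVAlgebra A] [MVAlgebra B] [MVAlgebra C]

theorem IsMVHom.comp {g : B → C} {f : A → B} (hg : IsMVHom g) (hf : IsMVHom f) :
    IsMVHom (g ∘ f) where
  map_oplus x y := by simp only [Function.comp, hf.map_oplus, hg.map_oplus]
  map_neg x := by simp only [Function.comp, hf.map_neg, hg.map_neg]
  map_zero := by simp only [Function.comp, hf.map_zero, hg.map_zero]

theorem IsMVHom.symm {e : A ≃ B} (he : IsMVHom e) : IsMVHom e.symm where
  map_oplus x y := by rw [Equiv.symm_apply_eq, he.map_oplus]; simp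
  map_neg x := by rw [Equiv.symm_apply_eq, he.map_neg]; simp
  map_zero := by rw [Equiv.symm_apply_eq, he.map_zero]

theorem IsMVHom.nmul {f : A → B} (hf : IsMVHom f) (n : ℕ) (x : A) :
    f (nmul n x) = nmul n (f x) := by
  induction n with
  | zero => exact hf.map_zero
  | succ n ih =>
    change f (MVAlgebra.nmul n x ⊹ x) = MVAlgebra.nmul n (f x) ⊹ f x
    rw [hf.map_oplus, ih]

theorem MVAlgebra.IsPotent.of_surjective {f : A → B} (hf : IsMVHom f)
    (hs : Function.Surjective f) {N : ℕ} (h : IsPotent A N) : IsPotent B N := by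
  intro y
  obtain ⟨x, rfl⟩ := hs y
  rw [← hf.nmul, ← hf.nmul, h]

theorem IsMVHom.eval {ι : Type*} (A : ι → Type*) [∀ i, MVAlgebra (A i)] (i : ι) :
    IsMVHom (fun x : ∀ i, A i => x i) :=
  ⟨fun _ _ => rfl, fun _ => rfl, rfl⟩

theorem IsMVHom.pi {ι : Type*} {B : ι → Type*} [∀ i, MVAlgebra (B i)] {f : ∀ i, A → B i}
    (hf : ∀ i, IsMVHom (f i)) : IsMVHom (fun x i => f i x) where
  map_oplus x y := funext fun i => (hf i).map_oplus x y
  map_neg x := funext fun i => (hf i).map_neg x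
  map_zero := funext fun i => (hf i).map_zero

/-- The range of a homomorphism. -/
def IsMVHom.range {f : A → B} (hf : IsMVHom f) : MVSubalgebra B where
  carrier := Set.range f
  oplus_mem := by
    rintro _ _ ⟨x, rfl⟩ ⟨y, rfl⟩
    exact ⟨x ⊹ y, hf.map_oplus x y⟩
  neg_mem := by
    rintro _ ⟨x, rfl⟩
    exact ⟨∼x, hf.map_neg x⟩
  zero_mem := ⟨zero, hf.map_zero⟩

theorem MVSubalgebra.subset_closure (s : Set A) : s ⊆ (closure s).carrier :=
  fun _ hx _ hS => hS hx

theorem MVSubalgebra.nmul_mem (S : MVSubalgebra A) {x : A} (hx : x ∈ S.carrier) (n : ℕ) :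
    MVAlgebra.nmul n x ∈ S.carrier := by
  induction n with
  | zero => exact S.zero_mem
  | succ n ih => exact S.oplus_mem ih hx

end Hom

/-! ### Quasivarieties -/

namespace IsMVQuasivariety

variable {K : Set MVAlg.{u}}

theorem mem_of_injective (hK : IsMVQuasivariety K) {A B : MVAlg.{u}} (hB : B ∈ K) {f : A → B}
    (hf : IsMVHom f) (hi : Function.Injective f) : A ∈ K := by
  refine hK.closed_iso _ (hK.closed_sub B hB hf.range) A (Equiv.ofInjective f hi).symm
    (IsMVHom.symm (A := A) (B := hf.range.carrier) (e := Equiv.ofInjective f hi) ?_)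
    (Equiv.bijective _)
  exact ⟨fun x y => Subtype.ext (hf.map_oplus x y), fun x => Subtype.ext (hf.map_neg x),
    Subtype.ext hf.map_zero⟩

theorem pi_mem (hK : IsMVQuasivariety K) {ι : Type u} {A : ι → MVAlg.{u}} (hA : ∀ i, A i ∈ K) :
    MVAlg.of (∀ i, A i) ∈ K := by
  -- The only member of the filter `⊤` is the whole index set, so this reduced product identifies
  -- nothing.
  refine hK.mem_of_injective (hK.closed_reducedProd ι ⊤ A hA)
    (f := Quotient.mk (Filter.productSetoid ⊤ fun i => A i)) ⟨fun _ _ => rfl, fun _ => rfl, rfl⟩ ?_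
  intro x y hxy
  have h : ∀ᶠ i in ⊤, x i = y i := Quotient.exact hxy
  rw [Filter.eventually_top] at h
  exact funext h

open Classical in
/-- A quasivariety contains every algebra all of whose finitely generated subalgebras it
contains. -/
theorem mem_of_closure_mem (hK : IsMVQuasivariety K) {A : MVAlg.{u}}
    (h : ∀ s : Set A, s.Finite → MVAlg.of (MVSubalgebra.closure s).carrier ∈ K) : A ∈ K := by
  let S : Finset A → MVSubalgebra A := fun s => MVSubalgebra.closure (s : Set A)
  -- The default `zero` is harmless: `a` lies in `S s` once `a ∈ s`, which holds eventually along
  -- `atTop`.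
  let φ : A → ∀ s : Finset A, MVAlg.of (S s).carrier := fun a s =>
    if ha : a ∈ (S s).carrier then ⟨a, ha⟩ else ⟨zero, (S s).zero_mem⟩
  have hval : ∀ {a : A} {s : Finset A}, a ∈ (S s).carrier → (φ a s).1 = a :=
    fun {a s} ha => congrArg Subtype.val (dif_pos ha)
  have hev : ∀ a : A, ∀ᶠ s : Finset A in Filter.atTop, a ∈ (S s).carrier := fun a =>
    (Filter.eventually_ge_atTop {a}).mono fun s hs =>
      MVSubalgebra.subset_closure (s : Set A) (hs (Finset.mem_singleton_self a))
  refine hK.mem_of_injective (hK.closed_reducedProd (Finset A) Filter.atTop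
    (fun s => MVAlg.of (S s).carrier) fun s => h s s.finite_toSet)
    (f := fun a => Quotient.mk (Filter.productSetoid Filter.atTop fun s =>
      (MVAlg.of (S s).carrier : Type u)) (φ a)) ⟨fun x y => ?_, fun x => ?_, ?_⟩ ?_
  · refine Quotient.sound ?_
    filter_upwards [hev x, hev y] with s hx hy
    apply Subtype.ext
    rw [hval ((S s).oplus_mem hx hy)]
    exact congrArg₂ oplus (hval hx).symm (hval hy).symm
  · refine Quotient.sound ?_
    filter_upwards [hev x] with s hx
    apply Subtype.ext
    rw [hval ((S s).neg_mem hx)]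
    exact congrArg neg (hval hx).symm
  · refine Quotient.sound ?_
    exact Filter.Eventually.of_forall fun s => Subtype.ext (hval (S s).zero_mem)
  · intro x y hxy
    have h1 : ∀ᶠ s in Filter.atTop, φ x s = φ y s := Quotient.exact hxy
    obtain ⟨s, hs, hx, hy⟩ := (h1.and ((hev x).and (hev y))).exists
    rw [← hval hx, ← hval hy, hs]

end IsMVQuasivariety

/-- A locally finite class closed under direct products satisfies `(N + 1) x = N x` for some `N`. -/
theorem exists_isPotent {K : Set MVAlg.{u}} (hfin : IsLocallyFiniteMVClass K)
    (hprod : ∀ (ι : Type u) (A : ι → MVAlg.{u}), (∀ i, A i ∈ K) → MVAlg.of (∀ i, A i) ∈ K) :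
    ∃ N, ∀ A ∈ K, IsPotent A N := by
  by_contra! hcon
  choose A hA hpot using hcon
  simp only [IsPotent, not_forall] at hpot
  choose x hx using hpot
  let x' : ∀ i : ULift.{u} ℕ, A i.down := fun i => x i.down
  have hfin' := hfin _ (hprod (ULift.{u} ℕ) (fun i => A i.down) fun i => hA _) {x'}
    (Set.finite_singleton _)
  have hmem : ∀ n, nmul n x' ∈ (MVSubalgebra.closure {x'}).carrier := fun n =>
    MVSubalgebra.nmul_mem _ (MVSubalgebra.subset_closure _ (Set.mem_singleton x')) n
  have : ¬ Function.Injective fun n => nmul n x' := fun hinj =>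
    (Set.infinite_range_of_injective hinj) (hfin'.subset (Set.range_subset_iff.2 hmem))
  obtain ⟨a, b, hab, hlt⟩ : ∃ a b, nmul a x' = nmul b x' ∧ a < b := by
    simp only [Function.Injective, not_forall] at this
    obtain ⟨a, b, hab, hne⟩ := this
    rcases lt_or_gt_of_ne hne with h | h
    exacts [⟨a, b, hab, h⟩, ⟨b, a, hab.symm, h⟩]
  -- Coordinate `a` is where the law was assumed to fail for exponent `a`; since `a < b`, the
  -- repetition forces it there.
  have heq : nmul a (x a) = nmul b (x a) := by
    have h1 := IsMVHom.eval (fun i : ULift.{u} ℕ => (A i.down : Type u)) ⟨a⟩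
    have h2 := congrFun hab ⟨a⟩
    exact ((h1.nmul a x').symm.trans h2).trans (h1.nmul b x')
  refine hx a (Le.antisymm ?_ (nmul_le (Nat.le_succ a) _))
  rw [heq]
  exact nmul_le hlt _

/-! ### Decomposition of finite algebras along idempotents -/

/-- The congruence collapsing the idempotent `e` to `0`. -/
def MVAlgebra.idempotentSetoid {A : Type u} [MVAlgebra A] (e : A) : Setoid A where
  r x y := x ⊹ e = y ⊹ e
  iseqv := ⟨fun _ => rfl, Eq.symm, Eq.trans⟩

/-- The quotient of an MV-algebra by an idempotent. -/
def MVAlg.idempotentQuotient (A : MVAlg.{u}) {e : A} (he : e ⊹ e = e) : MVAlg.{u} where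
  carrier := Quotient (idempotentSetoid e)
  str :=
    { oplus := Quotient.map₂ oplus (by
        intro x x' hx y y' hy
        change x ⊹ y ⊹ e = x' ⊹ y' ⊹ e
        have hx' : x ⊹ e = x' ⊹ e := hx
        have hy' : y ⊹ e = y' ⊹ e := hy
        rw [← he, oplus_oplus_oplus_comm x, hx', hy', ← oplus_oplus_oplus_comm x'])
      neg := Quotient.map neg (by
        intro x x' hx
        change ∼x ⊹ e = ∼x' ⊹ e
        have hx' : x ⊹ e = x' ⊹ e := hx
        rw [← neg_oplus_idempotent he x, hx', neg_oplus_idempotent he])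
      zero := Quotient.mk _ zero
      oplus_assoc := by
        rintro ⟨x⟩ ⟨y⟩ ⟨z⟩
        exact congrArg (Quotient.mk _) (oplus_assoc x y z)
      oplus_comm := by
        rintro ⟨x⟩ ⟨y⟩
        exact congrArg (Quotient.mk _) (oplus_comm x y)
      oplus_zero := by
        rintro ⟨x⟩
        exact congrArg (Quotient.mk _) (oplus_zero x)
      neg_neg := by
        rintro ⟨x⟩
        exact congrArg (Quotient.mk _) (MVAlgebra.neg_neg x)
      oplus_neg_zero := by
        rintro ⟨x⟩
        exact congrArg (Quotient.mk _) (oplus_neg_zero x)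
      oplus_symm := by
        rintro ⟨x⟩ ⟨y⟩
        exact congrArg (Quotient.mk _) (oplus_symm x y) }

namespace MVAlg

/-- The quotient map by an idempotent. -/
def idempotentMk (A : MVAlg.{u}) {e : A} (he : e ⊹ e = e) : A → A.idempotentQuotient he :=
  Quotient.mk _

variable {A : MVAlg.{u}} {e : A} (he : e ⊹ e = e)

theorem isMVHom_idempotentMk : IsMVHom (A.idempotentMk he) :=
  ⟨fun _ _ => rfl, fun _ => rfl, rfl⟩

theorem idempotentMk_surjective : Function.Surjective (A.idempotentMk he) :=
  Quotient.mk_surjective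

theorem idempotentMk_eq_iff {x y : A} :
    A.idempotentMk he x = A.idempotentMk he y ↔ x ⊹ e = y ⊹ e :=
  ⟨fun h => Quotient.exact h, fun h => Quotient.sound h⟩

/-- Both components of `x` in `split_idempotent` are functions of `x ⊹ e` and `x ⊹ ∼e`. With
`exists_idempotentMk_eq` this makes `A` the product of its quotients by `e` and `∼e`. -/
theorem idempotentMk_prod_injective {x y : A}
    (h : A.idempotentMk he x = A.idempotentMk he y)
    (h' : A.idempotentMk (neg_idempotent he) x = A.idempotentMk (neg_idempotent he) y) :
    x = y := by
  rw [idempotentMk_eq_iff] at h h'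
  rw [← split_idempotent he x, ← split_idempotent he y, ← neg_oplus_idempotent he x,
    ← neg_oplus_idempotent (neg_idempotent he) x, h, h', neg_oplus_idempotent he,
    neg_oplus_idempotent (neg_idempotent he)]

theorem exists_idempotentMk_eq (x y : A) : ∃ z : A,
    A.idempotentMk he z = A.idempotentMk he x ∧
      A.idempotentMk (neg_idempotent he) z = A.idempotentMk (neg_idempotent he) y := by
  -- The component of `x` outside `e` plus that of `y` inside `e`: each quotient kills one summand.
  refine ⟨∼(∼x ⊹ e) ⊹ ∼(∼y ⊹ ∼e), ?_, ?_⟩ <;> rw [idempotentMk_eq_iff]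
  · rw [oplus_assoc, neg_oplus_neg_oplus_idempotent he, sup_idempotent he]
  · have := neg_oplus_neg_oplus_idempotent (neg_idempotent he) (∼x)
    rw [MVAlgebra.neg_neg] at this
    rw [oplus_right_comm, this, oplus_comm, sup_idempotent (neg_idempotent he)]

theorem card_idempotentQuotient_lt [Finite A] (h0 : e ≠ zero) :
    Nat.card (A.idempotentQuotient he) < Nat.card A := by
  have hs := idempotentMk_surjective he
  have := Finite.of_surjective _ hs
  have := Fintype.ofFinite A
  have := Fintype.ofFinite (A.idempotentQuotient he)
  rw [Nat.card_eq_fintype_card, Nat.card_eq_fintype_card]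
  refine Fintype.card_lt_of_surjective_not_injective _ hs fun hinj => h0 ?_
  apply hinj
  rw [idempotentMk_eq_iff, he, zero_oplus]

end MVAlg

/-! ### Products of algebras of bounded size -/

/-- The MV-algebras with underlying type `Fin k`, where `k < n`. -/
abbrev BoundedMV (n : ℕ) : Type u := Σ k : Fin n, MVAlgebra (ULift.{u} (Fin k))

theorem MVAlgebra.finite_of_finite (A : Type u) [Finite A] : Finite (MVAlgebra A) := by
  refine Finite.of_injective
    (fun M : MVAlgebra A => (M.oplus, M.neg, M.zero)) ?_
  rintro ⟨⟩ ⟨⟩ h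
  simp only [Prod.mk.injEq] at h
  obtain ⟨rfl, rfl, rfl⟩ := h
  rfl

instance (n : ℕ) : Finite (BoundedMV.{u} n) :=
  have (k : Fin n) : Finite (MVAlgebra (ULift.{u} (Fin k))) := MVAlgebra.finite_of_finite _
  inferInstance

/-- The bundled algebra of a `BoundedMV`. -/
def BoundedMV.toAlg {n : ℕ} (t : BoundedMV.{u} n) : MVAlg.{u} := ⟨ULift.{u} (Fin t.1), t.2⟩

/-- A finite algebra of cardinality less than `n` is isomorphic to a `BoundedMV n`. -/
theorem BoundedMV.exists_equiv {n : ℕ} (A : MVAlg.{u}) [Finite A] (h : Nat.card A < n) :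
    ∃ (t : BoundedMV.{u} n) (e : A ≃ t.toAlg), IsMVHom e := by
  let e : A ≃ ULift.{u} (Fin (Nat.card A)) := (Finite.equivFin A).trans Equiv.ulift.symm
  refine ⟨⟨⟨Nat.card A, h⟩,
    { oplus := fun x y => e (e.symm x ⊹ e.symm y)
      neg := fun x => e (∼(e.symm x))
      zero := e zero
      oplus_assoc := fun x y z => by simp [oplus_assoc]
      oplus_comm := fun x y => by rw [oplus_comm]
      oplus_zero := fun x => by simp [oplus_zero]
      neg_neg := fun x => by simp [MVAlgebra.neg_neg]
      oplus_neg_zero := fun x => by simp [oplus_neg_zero]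
      oplus_symm := fun x y => by simp [oplus_symm] }⟩, e, ?_⟩
  refine ⟨fun x y => ?_, fun x => ?_, rfl⟩
  · exact congrArg e (congrArg₂ oplus (e.symm_apply_apply x) (e.symm_apply_apply y)).symm
  · exact congrArg e (congrArg neg (e.symm_apply_apply x)).symm

/-- A finite algebra with `(N + 1) x = N x` is a direct product of algebras with at most `N + 1`
elements. -/
theorem MVAlgebra.IsPotent.exists_pi_equiv {N : ℕ} (A : MVAlg.{u}) [Finite A]
    (h : IsPotent A N) : ∃ (ι : Type u) (τ : ι → BoundedMV.{u} (N + 2))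
      (f : A → ∀ i, (τ i).toAlg), IsMVHom f ∧ Function.Bijective f := by
  induction hn : Nat.card A using Nat.strong_induction_on generalizing A with
  | _ n ih =>
    by_cases hid : ∀ e : A, e ⊹ e = e → e = zero ∨ e = ∼zero
    · obtain ⟨a, ha⟩ := h.exists_generator hid
      -- The multiples `0, …, N` of `a` number at most `N + 1`; `BoundedMV` bounds sizes strictly.
      have hcard : Nat.card A < N + 2 := by
        have hs : Function.Surjective fun j : Fin (N + 1) => nmul j.1 a := fun x => by
          obtain ⟨j, hj, rfl⟩ := ha x
          exact ⟨⟨j, by omega⟩, rfl⟩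
        have := Nat.card_le_card_of_surjective _ hs
        rw [Nat.card_fin] at this
        omega
      obtain ⟨t, e, he⟩ := BoundedMV.exists_equiv A hcard
      refine ⟨PUnit, fun _ => t, fun x _ => e x, IsMVHom.pi fun _ => he, ?_, ?_⟩
      · exact fun x y hxy => e.injective (congrFun hxy PUnit.unit)
      · exact fun y => ⟨e.symm (y PUnit.unit), funext fun _ => e.apply_symm_apply _⟩
    · push Not at hid
      obtain ⟨e, he, h0, h1⟩ := hid
      have h1' : ∼e ≠ zero := fun h' => h1 (by rw [← h', MVAlgebra.neg_neg])
      have hs := MVAlg.idempotentMk_surjective he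
      have hs' := MVAlg.idempotentMk_surjective (neg_idempotent he)
      have := Finite.of_surjective _ hs
      have := Finite.of_surjective _ hs'
      obtain ⟨ι, τ, f, hf, hfb⟩ := ih _ (hn ▸ MVAlg.card_idempotentQuotient_lt he h0) _
        (h.of_surjective (MVAlg.isMVHom_idempotentMk he) hs) rfl
      obtain ⟨ι', τ', f', hf', hfb'⟩ :=
        ih _ (hn ▸ MVAlg.card_idempotentQuotient_lt (neg_idempotent he) h1') _
        (h.of_surjective (MVAlg.isMVHom_idempotentMk (neg_idempotent he)) hs') rfl
      let g : A → ∀ i : ι ⊕ ι', (Sum.elim τ τ' i).toAlg := fun x =>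
        Sum.rec (fun i => f (A.idempotentMk he x) i)
          (fun i => f' (A.idempotentMk (neg_idempotent he) x) i)
      refine ⟨ι ⊕ ι', Sum.elim τ τ', g, ⟨fun x y => ?_, fun x => ?_, ?_⟩, fun x y hxy => ?_,
        fun y => ?_⟩
      · funext i
        cases i with
        | inl i => exact congrFun ((hf.comp (MVAlg.isMVHom_idempotentMk he)).map_oplus x y) i
        | inr i => exact congrFun ((hf'.comp (MVAlg.isMVHom_idempotentMk _)).map_oplus x y) i
      · funext i
        cases i with
        | inl i => exact congrFun ((hf.comp (MVAlg.isMVHom_idempotentMk he)).map_neg x) i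
        | inr i => exact congrFun ((hf'.comp (MVAlg.isMVHom_idempotentMk _)).map_neg x) i
      · funext i
        cases i with
        | inl i => exact congrFun (hf.comp (MVAlg.isMVHom_idempotentMk he)).map_zero i
        | inr i => exact congrFun (hf'.comp (MVAlg.isMVHom_idempotentMk _)).map_zero i
      · exact MVAlg.idempotentMk_prod_injective he
          (hfb.1 (funext fun i => congrFun hxy (Sum.inl i)))
          (hfb'.1 (funext fun i => congrFun hxy (Sum.inr i)))
      · obtain ⟨x, hx⟩ := hfb.2 fun i => y (Sum.inl i)
        obtain ⟨x', hx'⟩ := hfb'.2 fun i => y (Sum.inr i)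
        obtain ⟨x, rfl⟩ := hs x
        obtain ⟨x', rfl⟩ := hs' x'
        obtain ⟨z, hz, hz'⟩ := MVAlg.exists_idempotentMk_eq he x x'
        refine ⟨z, funext fun i => ?_⟩
        cases i with
        | inl i => exact (congrFun (congrArg f hz) i).trans (congrFun hx i)
        | inr i => exact (congrFun (congrArg f' hz') i).trans (congrFun hx' i)

theorem BoundedMV.isMVHom_cast {n : ℕ} {s t : BoundedMV.{u} n} (h : s = t) :
    IsMVHom (fun x : s.toAlg => (h ▸ x : t.toAlg)) := by
  subst h
  exact ⟨fun _ _ => rfl, fun _ => rfl, rfl⟩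

theorem BoundedMV.cast_injective {n : ℕ} {s t : BoundedMV.{u} n} (h : s = t) :
    Function.Injective (fun x : s.toAlg => (h ▸ x : t.toAlg)) := by
  subst h
  exact fun _ _ h => h

open Classical in
/-- Whether a quasivariety contains a direct product only depends on the set of factors. -/
theorem IsMVQuasivariety.pi_mem_of_range_eq {K : Set MVAlg.{u}} (hK : IsMVQuasivariety K) {n : ℕ}
    {ι κ : Type u} {τ : ι → BoundedMV.{u} n} {ρ : κ → BoundedMV.{u} n}
    (hr : Set.range τ = Set.range ρ) (h : MVAlg.of (∀ j, (ρ j).toAlg) ∈ K) :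
    MVAlg.of (∀ i, (τ i).toAlg) ∈ K := by
  have hex : ∀ j, ∃ i, τ i = ρ j := fun j => hr.superset (Set.mem_range_self j)
  choose σ hσ using hex
  -- Each way of picking, for every `j`, a factor of `τ` equal to `ρ j` gives a homomorphism to the
  -- product over `ρ`; jointly they embed into a power of it.
  let M := {f : κ → ι // ∀ j, τ (f j) = ρ j}
  let g : (∀ i, (τ i).toAlg) → ∀ f : M, MVAlg.of (∀ j, (ρ j).toAlg) :=
    fun x f j => (f.2 j ▸ x (f.1 j) : (ρ j).toAlg)
  refine hK.mem_of_injective (A := MVAlg.of (∀ i, (τ i).toAlg))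
    (hK.pi_mem (A := fun _ : M => MVAlg.of (∀ j, (ρ j).toAlg)) fun _ => h) (f := g) ?_ ?_
  · exact IsMVHom.pi fun f => IsMVHom.pi fun j =>
      (BoundedMV.isMVHom_cast (f.2 j)).comp (IsMVHom.eval (fun i => (τ i).toAlg) (f.1 j))
  · intro x y hxy
    funext i
    obtain ⟨j, hj⟩ : τ i ∈ Set.range ρ := hr.subset (Set.mem_range_self i)
    -- Redirecting `σ` at `j` to `i` gives a choice that sees coordinate `i`.
    have hf : ∀ j', τ (Function.update σ j i j') = ρ j' := fun j' => by
      rcases eq_or_ne j' j with rfl | hne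
      · rw [Function.update_self, hj]
      · rw [Function.update_of_ne hne, hσ]
    have h1 : x (Function.update σ j i j) = y (Function.update σ j i j) :=
      BoundedMV.cast_injective (hf j) (congrFun (congrFun hxy ⟨_, hf⟩) j)
    rwa [Function.update_self] at h1

/-- The sets of factors of the products of bounded algebras in a class. -/
def factorSets (n : ℕ) (K : Set MVAlg.{u}) : Set (Set (BoundedMV.{u} n)) :=
  {S | ∃ (ι : Type u) (τ : ι → BoundedMV.{u} n),
    Set.range τ = S ∧ MVAlg.of (∀ i, (τ i).toAlg) ∈ K}

/-- A finitely generated subalgebra of a member of `K` is a product of bounded algebras; `L`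
contains a product with the same set of factors, hence this one too. -/
theorem subset_of_factorSets_subset {N : ℕ} {K L : Set MVAlg.{u}} (hK : IsMVQuasivariety K)
    (hfin : IsLocallyFiniteMVClass K) (hpot : ∀ A ∈ K, IsPotent A N) (hL : IsMVQuasivariety L)
    (h : factorSets (N + 2) K ⊆ factorSets (N + 2) L) : K ⊆ L := by
  intro A hA
  refine hL.mem_of_closure_mem fun s hs => ?_
  have hB := hK.closed_sub A hA (MVSubalgebra.closure s)
  have : Finite (MVAlg.of (MVSubalgebra.closure s).carrier) := (hfin A hA s hs).to_subtype
  obtain ⟨ι, τ, f, hf, hfb⟩ := IsPotent.exists_pi_equiv _ (hpot _ hB)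
  have hmem : MVAlg.of (∀ i, (τ i).toAlg) ∈ K := hK.closed_iso _ hB _ f hf hfb
  obtain ⟨κ, ρ, hr, hρ⟩ := h ⟨ι, τ, rfl, hmem⟩
  exact hL.mem_of_injective (hL.pi_mem_of_range_eq hr.symm hρ) (f := f) hf hfb.1

/-- There are finitely many locally finite quasivarieties satisfying `(N + 1) x = N x`. -/
theorem finite_quasivarieties_isPotent (N : ℕ) :
    {K : Set MVAlg.{u} | IsMVQuasivariety K ∧ IsLocallyFiniteMVClass K ∧
      ∀ A ∈ K, IsPotent A N}.Finite := by
  refine Set.Finite.of_finite_image (f := factorSets (N + 2)) (Set.toFinite _) ?_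
  rintro K ⟨hK, hKf, hKp⟩ L ⟨hL, hLf, hLp⟩ heq
  exact (subset_of_factorSets_subset hK hKf hKp hL heq.subset).antisymm
    (subset_of_factorSets_subset hL hLf hLp hK heq.superset)

theorem corollary2p8 :
    (∀ V : Set MVAlg.{u}, IsMVVariety V → IsLocallyFiniteMVClass V →
      {K : Set MVAlg.{u} | IsMVQuasivariety K ∧ K ⊆ V}.Finite) ∧
    {K : Set MVAlg.{u} | IsMVQuasivariety K ∧ IsLocallyFiniteMVClass K}.Countable := by
  refine ⟨fun V hV hfin => ?_, ?_⟩
  · obtain ⟨N, hN⟩ := exists_isPotent hfin hV.closed_prod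
    exact (finite_quasivarieties_isPotent N).subset fun K hK =>
      ⟨hK.1, fun A hA => hfin A (hK.2 hA), fun A hA => hN A (hK.2 hA)⟩
  · refine (Set.countable_iUnion fun N => (finite_quasivarieties_isPotent.{u} N).countable).mono ?_
    rintro K ⟨hK, hfin⟩
    -- Closure under direct products is all that is needed here, and quasivarieties have it.
    obtain ⟨N, hN⟩ := exists_isPotent hfin fun ι A hA => hK.pi_mem hA
    exact Set.mem_iUnion.2 ⟨N, hK, hfin, hN⟩
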